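/- Let $M$ be a non-orientable connected smooth manifold of dimension $n$ (without boundary, Hausdorff, second countable). Then there exist a connected orientable smooth $n$-manifold $\bar M$ (again without boundary, Hausdorff, second countable) and a smooth two-fold covering $p:\bar M\to M$ such that for every diffeomorphism $f:M\to M$ there is a diffeomorphism $\bar f:\bar M\to\bar M$ with $p\circ\bar f=f\circ p$. Here smooth means $C^\infty$; a smooth manifold is orientable if it has a smooth atlas, compatible with its smooth structure, all of whose transition maps have positive Jacobian determinant; and a smooth two-fold covering is a covering map that is a $C^\infty$ local diffeomorphism and each of whose fibres has exactly two points. -/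

import Mathlib

open scoped Manifold ContDiff

universe u

/-- An oriented atlas of a (boundaryless) smooth `n`-manifold `M`: a family of charts of the
maximal smooth atlas that covers `M` and whose transition maps have positive Jacobian determinant
wherever they are defined. -/
structure IsOrientedAtlas (n : ℕ) (M : Type*) [TopologicalSpace M]
    [ChartedSpace (EuclideanSpace ℝ (Fin n)) M]
    (A : Set (OpenPartialHomeomorph M (EuclideanSpace ℝ (Fin n)))) : Prop where
  subset_maximalAtlas : A ⊆ IsManifold.maximalAtlas (𝓡 n) ∞ M
  covers : ∀ x : M, ∃ e ∈ A, x ∈ e.source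
  det_pos : ∀ e ∈ A, ∀ e' ∈ A, ∀ x ∈ e.source ∩ e'.source,
    0 < (fderiv ℝ (fun v => e' (e.symm v)) (e x)).det

/-- A smooth `n`-manifold is orientable if it has an oriented atlas. -/
def IsOrientableManifold (n : ℕ) (M : Type*) [TopologicalSpace M]
    [ChartedSpace (EuclideanSpace ℝ (Fin n)) M] : Prop :=
  ∃ A : Set (OpenPartialHomeomorph M (EuclideanSpace ℝ (Fin n))), IsOrientedAtlas n M A

/-- A smooth two-fold covering between smooth `n`-manifolds: a covering map that is a smooth local
diffeomorphism and all of whose fibres have exactly two points (so it is surjective). -/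
structure IsSmoothTwoFoldCovering (n : ℕ) {N M : Type*}
    [TopologicalSpace N] [ChartedSpace (EuclideanSpace ℝ (Fin n)) N]
    [TopologicalSpace M] [ChartedSpace (EuclideanSpace ℝ (Fin n)) M] (p : N → M) : Prop where
  isCoveringMap : IsCoveringMap p
  isLocalDiffeomorph : IsLocalDiffeomorph (𝓡 n) (𝓡 n) ∞ p
  ncard_fiber : ∀ x : M, (p ⁻¹' {x}).ncard = 2

/-! The covering is the orientation cover: its points are pairs of a point of `M` and an orientation
of the tangent space there. An orientation is recorded as a sign in the preferred chart, and signs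
change by the sign of the determinant of the tangent coordinate change. That sign is locally
constant, so the pairs form a fibre bundle with discrete two-point fibre `ℤˣ`, hence a covering, and
the smooth structure is pulled back from `M`.

Each point of the cover is itself an orientation, so the cover is tautologically oriented. A
diffeomorphism lifts by transporting orientations along its derivative; the chain rule shows that
the lift of the inverse is inverse to it. If the cover were disconnected, a proper clopen piece
would meet each fibre exactly once and so give a continuous orientation of `M`, contrary to
hypothesis. -/

open Set Filter Topology Bundle

/-! ### Signs of determinants -/

section OrientSign

variable {E : Type*} [NormedAddCommGroup E] [NormedSpace ℝ E]

/-- The sign of the determinant of an endomorphism; meaningful for invertible ones. -/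
noncomputable def orientSign (A : E →L[ℝ] E) : ℤˣ :=
  if 0 < A.det then 1 else -1

theorem ContinuousLinearMap.det_comp (A B : E →L[ℝ] E) : (A ∘L B).det = A.det * B.det :=
  LinearMap.det_comp (A : E →ₗ[ℝ] E) (B : E →ₗ[ℝ] E)

theorem ContinuousLinearMap.det_ne_zero_of_comp_eq_id {A B : E →L[ℝ] E}
    (h : A ∘L B = .id ℝ E) : A.det ≠ 0 ∧ B.det ≠ 0 := by
  have h1 : A.det * B.det = 1 := by
    rw [← ContinuousLinearMap.det_comp, h]
    exact LinearMap.det_id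
  exact ⟨left_ne_zero_of_mul_eq_one h1, right_ne_zero_of_mul_eq_one h1⟩

theorem orientSign_eq_one_iff {A : E →L[ℝ] E} : orientSign A = 1 ↔ 0 < A.det := by
  unfold orientSign
  split_ifs with h <;> simp [h]

@[simp]
theorem orientSign_id : orientSign (.id ℝ E) = 1 := by
  rw [orientSign_eq_one_iff]
  exact zero_lt_one.trans_eq (LinearMap.det_id (A := ℝ) (M := E)).symm

theorem orientSign_comp {A B : E →L[ℝ] E} (hA : A.det ≠ 0) (hB : B.det ≠ 0) :
    orientSign (A ∘L B) = orientSign A * orientSign B := by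
  unfold orientSign
  rw [ContinuousLinearMap.det_comp]
  rcases hA.lt_or_gt with ha | ha <;> rcases hB.lt_or_gt with hb | hb
  · simp [mul_pos_of_neg_of_neg ha hb, ha.not_gt, hb.not_gt]
  · simp [(mul_neg_of_neg_of_pos ha hb).not_gt, ha.not_gt, hb]
  · simp [(mul_neg_of_pos_of_neg ha hb).not_gt, ha, hb.not_gt]
  · simp [mul_pos ha hb, ha, hb]

theorem isOpen_setOf_orientSign_eq (s : ℤˣ) :
    IsOpen {A : E →L[ℝ] E | A.det ≠ 0 ∧ orientSign A = s} := by
  have hc := ContinuousLinearMap.continuous_det (𝕜 := ℝ) (E := E)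
  rcases Int.units_eq_one_or s with rfl | rfl
  · convert! isOpen_lt continuous_const hc using 1
    ext A
    simp only [mem_ofPred_eq, orientSign_eq_one_iff]
    exact ⟨fun h => h.2, fun h => ⟨h.ne', h⟩⟩
  · convert! isOpen_lt hc continuous_const using 1
    ext A
    simp only [mem_ofPred_eq, orientSign]
    constructor
    · rintro ⟨h0, h⟩
      refine lt_of_le_of_ne (not_lt.1 fun h' => ?_) h0
      simp [h'] at h
    · intro h
      exact ⟨h.ne, by simp [h.not_gt]⟩

theorem ContinuousWithinAt.eventually_orientSign_eq {X : Type*} [TopologicalSpace X]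
    {A : X → E →L[ℝ] E} {x : X} {s : Set X} (hA : ContinuousWithinAt A s x) (hx : (A x).det ≠ 0) :
    ∀ᶠ y in 𝓝[s] x, orientSign (A y) = orientSign (A x) :=
  (hA.eventually ((isOpen_setOf_orientSign_eq _).mem_nhds ⟨hx, rfl⟩)).mono fun _ h => h.2

/-- Sign `-1` is realised by a hyperplane reflection. Dimension 0 is excluded because every
determinant there is 1. -/
theorem exists_continuousLinearEquiv_orientSign_eq {n : ℕ} (hn : n ≠ 0) (s : ℤˣ) :
    ∃ L : EuclideanSpace ℝ (Fin n) ≃L[ℝ] EuclideanSpace ℝ (Fin n),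
      (L : EuclideanSpace ℝ (Fin n) →L[ℝ] EuclideanSpace ℝ (Fin n)).det ≠ 0 ∧
      orientSign (L : EuclideanSpace ℝ (Fin n) →L[ℝ] EuclideanSpace ℝ (Fin n)) = s := by
  rcases Int.units_eq_one_or s with rfl | rfl
  · refine ⟨.refl ℝ _, ?_, orientSign_id⟩
    exact (LinearMap.det_id (A := ℝ) (M := EuclideanSpace ℝ (Fin n))).trans_ne one_ne_zero
  · let v : EuclideanSpace ℝ (Fin n) := EuclideanSpace.single ⟨0, Nat.pos_of_ne_zero hn⟩ 1
    have hv : v ≠ 0 := by simp [v]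
    let K : Submodule ℝ (EuclideanSpace ℝ (Fin n)) := (ℝ ∙ v)ᗮ
    let L := K.reflection.toContinuousLinearEquiv
    have hdet : (L : EuclideanSpace ℝ (Fin n) →L[ℝ] EuclideanSpace ℝ (Fin n)).det = -1 := by
      have h := K.det_reflection
      rw [Submodule.orthogonal_orthogonal, finrank_span_singleton hv] at h
      exact (congrArg LinearMap.det (by ext; rfl)).trans (h.trans (pow_one _))
    refine ⟨L, by rw [hdet]; norm_num, ?_⟩
    unfold orientSign
    rw [hdet]
    norm_num

end OrientSign

/-! ### Smooth structures pulled back along local homeomorphisms -/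

section PullbackManifold

variable {H : Type*} [TopologicalSpace H] {N M : Type*} [TopologicalSpace N] [TopologicalSpace M]
  [ChartedSpace H M] {p : N → M}

/-- The charted space structure on the source of a local homeomorphism pulled back from its
target. -/
@[reducible]
noncomputable def IsLocalHomeomorph.pullbackChartedSpace (hp : IsLocalHomeomorph p) :
    ChartedSpace H N where
  atlas := {c | ∃ φ : OpenPartialHomeomorph N M, p = φ ∧ ∃ e ∈ atlas H M, c = φ ≫ₕ e}
  chartAt y := (hp y).choose ≫ₕ chartAt H (p y)
  mem_chart_source y := by
    obtain ⟨h1, h2⟩ := (hp y).choose_spec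
    simp only [OpenPartialHomeomorph.trans_source, mem_inter_iff, mem_preimage]
    exact ⟨h1, by rw [← h2]; exact mem_chart_source H (p y)⟩
  chart_mem_atlas y := ⟨_, (hp y).choose_spec.2, _, chart_mem_atlas H (p y), rfl⟩

variable {E : Type*} [NormedAddCommGroup E] [NormedSpace ℝ E] (I : ModelWithCorners ℝ E H)
  (k : ℕ∞ω) [IsManifold I k M]

/-- Two local branches of `p` cancel in a change of charts, leaving a restriction of a transition
map of `M`. -/
theorem IsLocalHomeomorph.isManifold_pullback (hp : IsLocalHomeomorph p) :
    letI := hp.pullbackChartedSpace (H := H)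
    IsManifold I k N := by
  let := hp.pullbackChartedSpace (H := H)
  refine isManifold_of_contDiffOn I k N ?_
  rintro _ _ ⟨φ, hφ, e, he, rfl⟩ ⟨φ', hφ', e', he', rfl⟩
  have hc := (contDiffGroupoid k I).compatible he he'
  have hc' : ContDiffOn ℝ k (I ∘ (e.symm ≫ₕ e') ∘ I.symm)
    (I.symm ⁻¹' (e.symm ≫ₕ e').source ∩ range I) := (mem_groupoid_of_pregroupoid.1 hc).1
  have key : ∀ z, z ∈ ((φ ≫ₕ e).symm ≫ₕ (φ' ≫ₕ e')).source →
      z ∈ (e.symm ≫ₕ e').source ∧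
        ((φ ≫ₕ e).symm ≫ₕ (φ' ≫ₕ e')) z = (e.symm ≫ₕ e') z := by
    intro z hz
    simp only [OpenPartialHomeomorph.trans_symm_eq_symm_trans_symm,
      OpenPartialHomeomorph.trans_source, OpenPartialHomeomorph.symm_source, mem_inter_iff,
      mem_preimage, OpenPartialHomeomorph.coe_trans, Function.comp_apply] at hz ⊢
    have h : φ' (φ.symm (e.symm z)) = e.symm z := by
      rw [← hφ', hφ]
      exact φ.right_inv hz.1.2
    rw [h] at hz ⊢
    exact ⟨⟨hz.1.1, hz.2.2⟩, rfl⟩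
  refine (hc'.mono fun z hz => ⟨(key _ hz.1).1, hz.2⟩).congr fun z hz => ?_
  simp only [Function.comp_apply]
  rw [(key _ hz.1).2]

theorem IsLocalHomeomorph.isLocalDiffeomorph_pullback (hp : IsLocalHomeomorph p) :
    letI := hp.pullbackChartedSpace (H := H)
    IsLocalDiffeomorph I I k p := by
  let := hp.pullbackChartedSpace (H := H)
  have := hp.isManifold_pullback I k
  have hchart : ∀ (φ : OpenPartialHomeomorph N M), p = φ → ∀ x,
      φ ≫ₕ chartAt H x ∈ IsManifold.maximalAtlas I k N := fun φ hφ x =>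
    IsManifold.subset_maximalAtlas ⟨φ, hφ, _, chart_mem_atlas H x, rfl⟩
  intro y
  obtain ⟨φ, hy, hφ⟩ := hp y
  refine ⟨{ toPartialEquiv := φ.toPartialEquiv
            open_source := φ.open_source
            open_target := φ.open_target
            contMDiffOn_toFun := ?_
            contMDiffOn_invFun := ?_ }, hy, fun _ _ => congrFun hφ _⟩
  · intro z hz
    have hc := hchart φ hφ (φ z)
    have hzc : z ∈ (φ ≫ₕ chartAt H (φ z)).source := by simp [hz]
    have h1 := contMDiffAt_of_mem_maximalAtlas hc hzc
    have h2 : ContMDiffAt I I k (chartAt H (φ z)).symm ((φ ≫ₕ chartAt H (φ z)) z) :=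
      contMDiffAt_symm_of_mem_maximalAtlas (IsManifold.chart_mem_maximalAtlas _)
        (by simp)
    refine ((h2.comp z h1).congr_of_eventuallyEq ?_).contMDiffWithinAt
    filter_upwards [(φ ≫ₕ chartAt H (φ z)).open_source.mem_nhds hzc] with w hw
    simp only [OpenPartialHomeomorph.trans_source, mem_inter_iff, mem_preimage] at hw
    exact ((chartAt H (φ z)).left_inv hw.2).symm
  · intro z hz
    have hc := hchart φ hφ z
    have h1 : ContMDiffAt I I k (chartAt H z) z :=
      contMDiffAt_of_mem_maximalAtlas (IsManifold.chart_mem_maximalAtlas _) (mem_chart_source H z)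
    have hzt : chartAt H z z ∈ (φ ≫ₕ chartAt H z).target := by
      simp only [OpenPartialHomeomorph.trans_target, mem_inter_iff, mem_preimage,
        (chartAt H z).left_inv (mem_chart_source H z)]
      exact ⟨mem_chart_target H z, hz⟩
    have h2 := contMDiffAt_symm_of_mem_maximalAtlas hc hzt
    refine ((h2.comp z h1).congr_of_eventuallyEq ?_).contMDiffWithinAt
    filter_upwards [(chartAt H z).open_source.mem_nhds (mem_chart_source H z)] with w hw
    simp only [OpenPartialHomeomorph.trans_symm_eq_symm_trans_symm,
      OpenPartialHomeomorph.coe_trans, Function.comp_apply, (chartAt H z).left_inv hw]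
    rfl

end PullbackManifold

/-- By continuity, `g` agrees near each point with a local inverse of `p` composed with `p ∘ g`. -/
theorem IsLocalDiffeomorph.contMDiff_of_comp {E H : Type*} [NormedAddCommGroup E] [NormedSpace ℝ E]
    [TopologicalSpace H] {I : ModelWithCorners ℝ E H} {k : ℕ∞ω} {X N M : Type*}
    [TopologicalSpace X] [TopologicalSpace N] [TopologicalSpace M]
    [ChartedSpace H X] [ChartedSpace H N] [ChartedSpace H M] {p : N → M} {g : X → N}
    (hp : IsLocalDiffeomorph I I k p) (hg : Continuous g) (hpg : ContMDiff I I k (p ∘ g)) :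
    ContMDiff I I k g := by
  intro x
  have h := (hp (g x)).localInverse_contMDiffAt.comp x hpg.contMDiffAt
  exact h.congr_of_eventuallyEq
    (((hp (g x)).localInverse_eventuallyEq_left.comp_tendsto hg.continuousAt).symm)

/-! ### The orientation bundle and its topology -/

section OrientationCover

variable (n : ℕ) {X Y M : Type*} [TopologicalSpace X] [TopologicalSpace Y] [TopologicalSpace M]
  [ChartedSpace (EuclideanSpace ℝ (Fin n)) X] [ChartedSpace (EuclideanSpace ℝ (Fin n)) Y]
  [ChartedSpace (EuclideanSpace ℝ (Fin n)) M]
  [IsManifold (𝓡 n) 1 X] [IsManifold (𝓡 n) 1 Y] [IsManifold (𝓡 n) 1 M]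

theorem tangentBundleCore_coordChange_comp_eq_id (i j : atlas (EuclideanSpace ℝ (Fin n)) M) {x : M}
    (hi : x ∈ i.1.source) (hj : x ∈ j.1.source) :
    (tangentBundleCore (𝓡 n) M).coordChange i j x ∘L
      (tangentBundleCore (𝓡 n) M).coordChange j i x = .id ℝ _ := by
  ext1 v
  exact ((tangentBundleCore (𝓡 n) M).coordChange_comp j i j x ⟨⟨hj, hi⟩, hj⟩ v).trans
    ((tangentBundleCore (𝓡 n) M).coordChange_self j x hj v)

theorem tangentBundleCore_coordChange_det_ne_zero (i j : atlas (EuclideanSpace ℝ (Fin n)) M) {x : M}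
    (hi : x ∈ i.1.source) (hj : x ∈ j.1.source) :
    ((tangentBundleCore (𝓡 n) M).coordChange i j x).det ≠ 0 :=
  (ContinuousLinearMap.det_ne_zero_of_comp_eq_id
    (tangentBundleCore_coordChange_comp_eq_id n i j hi hj)).1

variable (M) in
/-- The bundle of orientations of the tangent spaces of a smooth manifold. -/
noncomputable def orientationCore :
    FiberBundleCore (atlas (EuclideanSpace ℝ (Fin n)) M) M ℤˣ where
  baseSet i := i.1.source
  isOpen_baseSet i := i.1.open_source
  indexAt := achart _
  mem_baseSet_at := mem_chart_source _
  coordChange i j x v := orientSign ((tangentBundleCore (𝓡 n) M).coordChange i j x) * v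
  coordChange_self i x hx v := by
    have : (tangentBundleCore (𝓡 n) M).coordChange i i x = .id ℝ _ := by
      ext1 v
      exact (tangentBundleCore (𝓡 n) M).coordChange_self i x hx v
    rw [this, orientSign_id, one_mul]
  continuousOn_coordChange i j := by
    rintro ⟨x, v⟩ ⟨hx, -⟩
    have h := ((tangentBundleCore (𝓡 n) M).continuousOn_coordChange i j x hx).eventually_orientSign_eq
      (tangentBundleCore_coordChange_det_ne_zero n i j hx.1 hx.2)
    have h1 : ContinuousWithinAt
        (fun y => orientSign ((tangentBundleCore (𝓡 n) M).coordChange i j y))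
        (i.1.source ∩ j.1.source) x :=
      continuousWithinAt_const.congr_of_eventuallyEq h rfl
    have h2 : ContinuousWithinAt
        (fun q : M × ℤˣ => orientSign ((tangentBundleCore (𝓡 n) M).coordChange i j q.1))
        ((i.1.source ∩ j.1.source) ×ˢ univ) (x, v) :=
      ContinuousWithinAt.comp (f := Prod.fst) (x := (x, v)) h1
        continuous_fst.continuousWithinAt (fun _ hq => hq.1)
    exact h2.mul continuous_snd.continuousWithinAt
  coordChange_comp i j k x hx v := by
    have : (tangentBundleCore (𝓡 n) M).coordChange i k x =
        (tangentBundleCore (𝓡 n) M).coordChange j k x ∘L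
          (tangentBundleCore (𝓡 n) M).coordChange i j x := by
      ext1 v
      exact ((tangentBundleCore (𝓡 n) M).coordChange_comp i j k x hx v).symm
    rw [this, orientSign_comp (tangentBundleCore_coordChange_det_ne_zero n j k hx.1.2 hx.2)
      (tangentBundleCore_coordChange_det_ne_zero n i j hx.1.1 hx.1.2), mul_assoc]

variable (M) in
/-- The orientation double cover of a smooth manifold. -/
abbrev OrientationCover := (orientationCore n M).TotalSpace

/-- The sign by which orientations of the tangent space at `x` (read in the preferred chart at `x`)
transform into the preferred chart at `x₀`. -/
noncomputable def tangentSign (x x₀ : M) : ℤˣ := orientSign (tangentCoordChange (𝓡 n) x x₀ x)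

/-- The derivative of `f` at `x`, read in the preferred charts. -/
noncomputable def mfderivCoord (f : X → Y) (x : X) :
    EuclideanSpace ℝ (Fin n) →L[ℝ] EuclideanSpace ℝ (Fin n) :=
  mfderiv (𝓡 n) (𝓡 n) f x

/-- The sign of the determinant of the derivative of `f` at `x`, read in the preferred charts. -/
noncomputable def mfderivSign (f : X → Y) (x : X) : ℤˣ := orientSign (mfderivCoord n f x)

variable {n}

/-- The orientation of the tangent space at the base point, read in the preferred chart. -/
def OrientationCover.sign (q : OrientationCover n M) : ℤˣ := q.2

/-- A point of the orientation cover from an orientation in the preferred chart at `x`. -/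
def OrientationCover.mk (x : M) (v : ℤˣ) : OrientationCover n M := ⟨x, v⟩

@[simp] theorem OrientationCover.sign_mk (x : M) (v : ℤˣ) :
    (OrientationCover.mk (n := n) x v).sign = v := rfl

@[simp] theorem OrientationCover.proj_mk (x : M) (v : ℤˣ) :
    (OrientationCover.mk (n := n) x v).proj = x := rfl

theorem OrientationCover.ext {q r : OrientationCover n M} (h : q.proj = r.proj)
    (h' : q.sign = r.sign) : q = r := by
  rcases q with ⟨x, v⟩
  rcases r with ⟨y, w⟩
  obtain rfl : x = y := h
  obtain rfl : v = w := h'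
  rfl

/-- In the trivialization at the base point of `h z₀` the fibre is discrete, so convergence of the
fibre coordinate means eventual equality. -/
theorem OrientationCover.continuousAt_iff {Z : Type*} [TopologicalSpace Z]
    {h : Z → OrientationCover n M} {z₀ : Z} :
    ContinuousAt h z₀ ↔ ContinuousAt (fun z => (h z).proj) z₀ ∧
      ∀ᶠ z in 𝓝 z₀, tangentSign n (h z).proj (h z₀).proj * (h z).sign = (h z₀).sign := by
  rw [FiberBundle.continuousAt_totalSpace]
  refine and_congr_right fun _ => ?_
  change ContinuousAt (fun z => ((orientationCore n M).localTrivAt (h z₀).proj (h z)).2) z₀ ↔ _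
  have h0 : ((orientationCore n M).localTrivAt (h z₀).proj (h z₀)).2 = (h z₀).sign :=
    congrArg Prod.snd ((orientationCore n M).localTrivAt_apply (h z₀))
  rw [ContinuousAt, nhds_discrete ℤˣ, tendsto_pure, h0]
  rfl

theorem OrientationCover.eventually_tangentSign_mul_sign (q₀ : OrientationCover n M) :
    ∀ᶠ q in 𝓝 q₀, tangentSign n q.proj q₀.proj * q.sign = q₀.sign :=
  (OrientationCover.continuousAt_iff.1 continuousAt_id).2

@[simp] theorem tangentSign_self (x : M) : tangentSign n x x = 1 := by
  have h : tangentCoordChange (𝓡 n) x x x = .id ℝ _ := by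
    ext1 v
    exact tangentCoordChange_self (mem_extChartAt_source x)
  rw [tangentSign, h, orientSign_id]

theorem orientSign_tangentCoordChange_self_left {x x₀ : M}
    (hx : x ∈ (chartAt (EuclideanSpace ℝ (Fin n)) x₀).source) :
    orientSign (tangentCoordChange (𝓡 n) x₀ x x) = tangentSign n x x₀ := by
  have hx' := mem_chart_source (EuclideanSpace ℝ (Fin n)) x
  have h := congrArg orientSign (tangentBundleCore_coordChange_comp_eq_id n
    (achart (EuclideanSpace ℝ (Fin n)) x₀) (achart (EuclideanSpace ℝ (Fin n)) x) hx hx')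
  rw [orientSign_comp (tangentBundleCore_coordChange_det_ne_zero n _ _ hx hx')
    (tangentBundleCore_coordChange_det_ne_zero n _ _ hx' hx), orientSign_id,
    mul_eq_one_iff_eq_inv, Int.units_inv_eq_self] at h
  exact h

omit [IsManifold (𝓡 n) 1 X] [IsManifold (𝓡 n) 1 Y] in
theorem IsLocalDiffeomorph.det_mfderivCoord_ne_zero {f : X → Y}
    (hf : IsLocalDiffeomorph (𝓡 n) (𝓡 n) ∞ f) (x : X) : (mfderivCoord n f x).det ≠ 0 := by
  let L : EuclideanSpace ℝ (Fin n) ≃L[ℝ] EuclideanSpace ℝ (Fin n) :=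
    hf.mfderivToContinuousLinearEquiv (by simp) x
  exact (ContinuousLinearMap.det_ne_zero_of_comp_eq_id L.coe_comp_coe_symm).1

/-- Read in the fixed charts at `x₀` and `f x₀`, the derivative is continuous and invertible, so its
sign is locally constant; the chain rule rewrites this in the moving preferred charts. -/
theorem IsLocalDiffeomorph.eventually_tangentSign_mul_mfderivSign {f : X → Y}
    (hf : IsLocalDiffeomorph (𝓡 n) (𝓡 n) ∞ f) (x₀ : X) :
    ∀ᶠ x in 𝓝 x₀, tangentSign n (f x) (f x₀) * mfderivSign n f x =
      mfderivSign n f x₀ * tangentSign n x x₀ := by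
  let D : X → EuclideanSpace ℝ (Fin n) →L[ℝ] EuclideanSpace ℝ (Fin n) :=
    inTangentCoordinates (𝓡 n) (𝓡 n) id f (mfderivCoord n f) x₀
  have hsource : ∀ᶠ x in 𝓝 x₀, x ∈ (chartAt (EuclideanSpace ℝ (Fin n)) x₀).source ∧
      f x ∈ (chartAt (EuclideanSpace ℝ (Fin n)) (f x₀)).source :=
    inter_mem (chart_source_mem_nhds _ x₀)
      (hf.contMDiff.continuous.continuousAt (chart_source_mem_nhds _ (f x₀)))
  have hdet : ∀ x, x ∈ (chartAt (EuclideanSpace ℝ (Fin n)) x₀).source →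
      f x ∈ (chartAt (EuclideanSpace ℝ (Fin n)) (f x₀)).source →
      (D x).det ≠ 0 ∧
        orientSign (D x) = tangentSign n (f x) (f x₀) * (mfderivSign n f x * tangentSign n x x₀) := by
    intro x hx hfx
    have h1 : (tangentCoordChange (𝓡 n) (f x) (f x₀) (f x)).det ≠ 0 :=
      tangentBundleCore_coordChange_det_ne_zero n _ _ (mem_chart_source _ (f x)) hfx
    have h2 : (tangentCoordChange (𝓡 n) x₀ x x).det ≠ 0 :=
      tangentBundleCore_coordChange_det_ne_zero n _ _ hx (mem_chart_source _ x)
    have h3 := hf.det_mfderivCoord_ne_zero x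
    have hD : D x = tangentCoordChange (𝓡 n) (f x) (f x₀) (f x) ∘L
        mfderivCoord n f x ∘L tangentCoordChange (𝓡 n) x₀ x x :=
      inTangentCoordinates_eq id f _ hx hfx
    have h23 : (mfderivCoord n f x ∘L tangentCoordChange (𝓡 n) x₀ x x).det ≠ 0 :=
      (ContinuousLinearMap.det_comp _ _).trans_ne (mul_ne_zero h3 h2)
    rw [hD]
    refine ⟨(ContinuousLinearMap.det_comp _ _).trans_ne (mul_ne_zero h1 h23), ?_⟩
    rw [orientSign_comp h1 h23, orientSign_comp h3 h2, orientSign_tangentCoordChange_self_left hx]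
    rfl
  have hcont : ContinuousAt D x₀ :=
    ((hf.contMDiff x₀).mfderiv_const (m := 0) (by simp)).continuousAt
  obtain ⟨hx₀, hfx₀⟩ := hsource.self_of_nhds
  have hev := ContinuousWithinAt.eventually_orientSign_eq
    ((continuousWithinAt_univ D x₀).2 hcont) (hdet x₀ hx₀ hfx₀).1
  rw [nhdsWithin_univ] at hev
  filter_upwards [hev, hsource] with x hx hs
  rw [(hdet x hs.1 hs.2).2, (hdet x₀ hx₀ hfx₀).2, tangentSign_self, tangentSign_self, one_mul,
    mul_one] at hx
  rw [← hx, mul_assoc, mul_assoc, Int.units_mul_self, mul_one]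

end OrientationCover

/-! ### Orientability from a continuous choice of signs -/

section Orientability

variable {n : ℕ} {X Y M : Type*} [TopologicalSpace X] [TopologicalSpace Y] [TopologicalSpace M]
  [ChartedSpace (EuclideanSpace ℝ (Fin n)) X] [ChartedSpace (EuclideanSpace ℝ (Fin n)) Y]
  [ChartedSpace (EuclideanSpace ℝ (Fin n)) M]

theorem mfderivCoord_comp {f : X → Y} {g : Y → M} {x : X}
    (hg : MDifferentiableAt (𝓡 n) (𝓡 n) g (f x)) (hf : MDifferentiableAt (𝓡 n) (𝓡 n) f x) :
    mfderivCoord n (g ∘ f) x = mfderivCoord n g (f x) ∘L mfderivCoord n f x :=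
  mfderiv_comp x hg hf

theorem mfderivCoord_id (x : X) : mfderivCoord n (id : X → X) x = .id ℝ _ := mfderiv_id

theorem Filter.EventuallyEq.mfderivCoord_eq {f g : X → Y} {x : X} (h : f =ᶠ[𝓝 x] g) :
    mfderivCoord n f x = mfderivCoord n g x := h.mfderiv_eq

theorem mfderivCoord_eq_fderiv (f : EuclideanSpace ℝ (Fin n) → EuclideanSpace ℝ (Fin n))
    (v : EuclideanSpace ℝ (Fin n)) : mfderivCoord n f v = fderiv ℝ f v := mfderiv_eq_fderiv

theorem det_mfderivCoord_ne_zero_of_mem_maximalAtlas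
    {e : OpenPartialHomeomorph X (EuclideanSpace ℝ (Fin n))}
    (he : e ∈ IsManifold.maximalAtlas (𝓡 n) ∞ X) {x : X} (hx : x ∈ e.source) :
    (mfderivCoord n e x).det ≠ 0 := by
  have h1 := (contMDiffAt_of_mem_maximalAtlas he hx).mdifferentiableAt (by simp)
  have h2 := (contMDiffAt_symm_of_mem_maximalAtlas he (e.map_source hx)).mdifferentiableAt (by simp)
  have h3 : (e.symm ∘ e) =ᶠ[𝓝 x] id := by
    filter_upwards [e.open_source.mem_nhds hx] with y hy using e.left_inv hy
  have h4 := h3.mfderivCoord_eq (n := n)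
  rw [mfderivCoord_comp h2 h1, mfderivCoord_id] at h4
  exact (ContinuousLinearMap.det_ne_zero_of_comp_eq_id h4).2

/-- Near `x`, `e'` is its transition map from `e` composed with `e`; if both charts have the same
sign, the transition must have sign 1. -/
theorem isOrientedAtlas_of_mfderivSign_eq (o : X → ℤˣ)
    (A : Set (OpenPartialHomeomorph X (EuclideanSpace ℝ (Fin n))))
    (hA : A ⊆ IsManifold.maximalAtlas (𝓡 n) ∞ X) (hcov : ∀ x : X, ∃ e ∈ A, x ∈ e.source)
    (ho : ∀ e ∈ A, ∀ x ∈ e.source, mfderivSign n e x = o x) : IsOrientedAtlas n X A := by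
  refine ⟨hA, hcov, fun e he e' he' x ⟨hx, hx'⟩ => ?_⟩
  have h1 := (contMDiffAt_of_mem_maximalAtlas (hA he) hx).mdifferentiableAt (by simp)
  have h2 := (contMDiffAt_symm_of_mem_maximalAtlas (hA he) (e.map_source hx)).mdifferentiableAt
    (by simp)
  have h3 := (contMDiffAt_of_mem_maximalAtlas (hA he') hx').mdifferentiableAt (by simp)
  have h4 : ((e' ∘ e.symm) ∘ e) =ᶠ[𝓝 x] e' := by
    filter_upwards [e.open_source.mem_nhds hx] with y hy
    simp only [Function.comp_apply, e.left_inv hy]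
  have h5 : MDifferentiableAt (𝓡 n) (𝓡 n) (e' ∘ e.symm) (e x) := by
    refine MDifferentiableAt.comp (e x) ?_ h2
    rwa [e.left_inv hx]
  have h6 := h4.mfderivCoord_eq (n := n)
  rw [mfderivCoord_comp h5 h1, mfderivCoord_eq_fderiv] at h6
  have h7 := det_mfderivCoord_ne_zero_of_mem_maximalAtlas (hA he) hx
  have h8 := det_mfderivCoord_ne_zero_of_mem_maximalAtlas (hA he') hx'
  rw [← h6, ContinuousLinearMap.det_comp] at h8
  have h9 := congrArg orientSign h6
  rw [orientSign_comp (left_ne_zero_of_mul h8) h7] at h9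
  have h10 : orientSign (mfderivCoord n e x) = orientSign (mfderivCoord n e' x) :=
    (ho e he x hx).trans (ho e' he' x hx').symm
  rw [h10, mul_eq_right] at h9
  exact orientSign_eq_one_iff.1 h9

variable [IsManifold (𝓡 n) ∞ X]

theorem mfderivSign_chartAt {x x₀ : X}
    (hx : x ∈ (chartAt (EuclideanSpace ℝ (Fin n)) x₀).source) :
    mfderivSign n (chartAt (EuclideanSpace ℝ (Fin n)) x₀) x = tangentSign n x x₀ :=
  congrArg orientSign (mfderiv_chartAt_eq_tangentCoordChange hx)

theorem isOrientableManifold_zero {X : Type*} [TopologicalSpace X] [ChartedSpace (EuclideanSpace ℝ (Fin 0)) X]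
    [IsManifold (𝓡 0) ∞ X] : IsOrientableManifold 0 X := by
  refine ⟨atlas _ X, IsManifold.subset_maximalAtlas,
    fun x => ⟨_, chart_mem_atlas _ x, mem_chart_source _ x⟩, fun e _ e' _ x _ => ?_⟩
  exact zero_lt_one.trans_eq (LinearMap.det_eq_one_of_subsingleton _).symm

/-- A manifold with a continuous choice of orientations of its tangent spaces is orientable. -/
theorem isOrientableManifold_of_eventually (o : X → ℤˣ)
    (ho : ∀ x₀, ∀ᶠ x in 𝓝 x₀, tangentSign n x x₀ * o x = o x₀) : IsOrientableManifold n X := by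
  rcases eq_or_ne n 0 with rfl | hn
  · exact isOrientableManifold_zero
  refine ⟨{e | e ∈ IsManifold.maximalAtlas (𝓡 n) ∞ X ∧ ∀ x ∈ e.source, mfderivSign n e x = o x},
    isOrientedAtlas_of_mfderivSign_eq o _ (fun e he => he.1) (fun x₀ => ?_) (fun e he => he.2)⟩
  -- Following the preferred chart by `L` corrects its sign at `x₀`; restricting to `W`, where `o`
  -- is constant as seen in that chart, makes it correct throughout.
  obtain ⟨L, hL0, hL⟩ := exists_continuousLinearEquiv_orientSign_eq hn (o x₀)
  obtain ⟨W, hW, hWo, hxW⟩ := eventually_nhds_iff.1 (ho x₀)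
  let e₀ := chartAt (EuclideanSpace ℝ (Fin n)) x₀
  let c := (e₀.restrOpen W hWo) ≫ₕ L.toHomeomorph.toOpenPartialHomeomorph
  have hcs : c.source = e₀.source ∩ W := by simp [c]
  have he₀ : e₀ ∈ IsManifold.maximalAtlas (𝓡 n) ∞ X := IsManifold.chart_mem_maximalAtlas x₀
  have hLd : ContMDiff (𝓡 n) (𝓡 n) ∞ L := L.contDiff.contMDiff
  have hLd' : ContMDiff (𝓡 n) (𝓡 n) ∞ L.symm := L.symm.contDiff.contMDiff
  refine ⟨c, ⟨?_, fun x hx => ?_⟩, ?_⟩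
  · refine c.mem_maximalAtlas_of_contMDiffOn ?_ ?_
    · exact hLd.comp_contMDiffOn
        ((contMDiffOn_of_mem_maximalAtlas he₀).mono (hcs ▸ inter_subset_left))
    · refine (contMDiffOn_symm_of_mem_maximalAtlas he₀).comp hLd'.contMDiffOn ?_
      intro v hv
      simp [c] at hv
      exact hv.1
  · rw [hcs] at hx
    have h1 : mfderivCoord n c x = L ∘L mfderivCoord n e₀ x := by
      have h := mfderivCoord_comp (n := n) (g := L) (hLd.mdifferentiableAt (by simp))
        ((contMDiffAt_of_mem_maximalAtlas he₀ hx.1).mdifferentiableAt (by simp))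
      rw [mfderivCoord_eq_fderiv, L.fderiv] at h
      exact h
    rw [mfderivSign, h1, orientSign_comp hL0 (det_mfderivCoord_ne_zero_of_mem_maximalAtlas he₀ hx.1),
      hL, ← hW x hx.2]
    have h2 : orientSign (mfderivCoord n e₀ x) = tangentSign n x x₀ := mfderivSign_chartAt hx.1
    rw [h2, mul_right_comm, Int.units_mul_self, one_mul]
  · rw [hcs]
    exact ⟨mem_chart_source _ x₀, hxW⟩

end Orientability

/-! ### Geometry of the orientation cover -/

namespace OrientationCover

variable {n : ℕ} {X M : Type*} [TopologicalSpace X] [TopologicalSpace M]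
  [ChartedSpace (EuclideanSpace ℝ (Fin n)) X] [ChartedSpace (EuclideanSpace ℝ (Fin n)) M]
  [IsManifold (𝓡 n) ∞ X] [IsManifold (𝓡 n) ∞ M]

theorem continuous_proj : Continuous (TotalSpace.proj : OrientationCover n M → M) :=
  FiberBundle.continuous_proj _ _

theorem isCoveringMap_proj : IsCoveringMap (TotalSpace.proj : OrientationCover n M → M) :=
  FiberBundle.isCoveringMap

noncomputable instance : ChartedSpace (EuclideanSpace ℝ (Fin n)) (OrientationCover n M) :=
  isCoveringMap_proj.isLocalHomeomorph.pullbackChartedSpace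

instance : IsManifold (𝓡 n) ∞ (OrientationCover n M) :=
  isCoveringMap_proj.isLocalHomeomorph.isManifold_pullback (𝓡 n) ∞

theorem isLocalDiffeomorph_proj :
    IsLocalDiffeomorph (𝓡 n) (𝓡 n) ∞ (TotalSpace.proj : OrientationCover n M → M) :=
  isCoveringMap_proj.isLocalHomeomorph.isLocalDiffeomorph_pullback (𝓡 n) ∞

theorem isSmoothTwoFoldCovering_proj :
    IsSmoothTwoFoldCovering n (TotalSpace.proj : OrientationCover n M → M) := by
  refine ⟨isCoveringMap_proj, isLocalDiffeomorph_proj, fun x => ?_⟩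
  have h : (TotalSpace.proj : OrientationCover n M → M) ⁻¹' {x} = range (mk (n := n) x) := by
    ext q
    constructor
    · rintro rfl
      exact ⟨sign q, rfl⟩
    · rintro ⟨v, rfl⟩
      rfl
  have hinj : Function.Injective (mk (n := n) x) := fun v w h => congrArg sign h
  rw [h, ← image_univ, ncard_image_of_injective _ hinj, ncard_univ, Nat.card_eq_fintype_card]
  rfl

instance [T2Space M] : T2Space (OrientationCover n M) where
  t2 q r hqr := by
    by_cases h : q.proj = r.proj
    · exact isCoveringMap_proj.isSeparatedMap q r h hqr
    · obtain ⟨U, V, hU, hV, hqU, hrV, hd⟩ := t2_separation h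
      exact ⟨_, _, hU.preimage continuous_proj, hV.preimage continuous_proj, hqU, hrV,
        hd.preimage _⟩

instance [SecondCountableTopology M] : SecondCountableTopology (OrientationCover n M) := by
  obtain ⟨s, hs, hcov⟩ := TopologicalSpace.countable_cover_nhds
    (fun x : M => chart_source_mem_nhds (EuclideanSpace ℝ (Fin n)) x)
  have := hs.to_subtype
  have hsec : ∀ x : s, SecondCountableTopology ((orientationCore n M).localTrivAt x.1).source :=
    fun x => ((orientationCore n M).localTrivAt x.1).toOpenPartialHomeomorph.secondCountableTopology_source
  refine TopologicalSpace.secondCountableTopology_of_countable_cover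
    (U := fun x : s => ((orientationCore n M).localTrivAt x.1).source)
    (fun x => ((orientationCore n M).localTrivAt x.1).open_source) (eq_univ_of_forall fun q => ?_)
  have hq := hcov.ge (mem_univ q.proj)
  simp only [mem_iUnion] at hq ⊢
  obtain ⟨x, hx, hq⟩ := hq
  exact ⟨⟨x, hx⟩, ((orientationCore n M).mem_localTrivAt_source q x).2 hq⟩

/-- The tautological orientation at `q` is `q` itself pulled back along the derivative of the
projection; that factor makes the sign refer to the preferred chart of the cover. -/
theorem isOrientableManifold : IsOrientableManifold n (OrientationCover n M) := by
  refine isOrientableManifold_of_eventually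
    (fun q => q.sign * mfderivSign n (TotalSpace.proj : OrientationCover n M → M) q) fun q₀ => ?_
  filter_upwards [isLocalDiffeomorph_proj.eventually_tangentSign_mul_mfderivSign q₀,
    eventually_tangentSign_mul_sign q₀] with q h1 h2
  rw [← h2]
  generalize mfderivSign n (TotalSpace.proj : OrientationCover n M → M) q = a at *
  generalize mfderivSign n (TotalSpace.proj : OrientationCover n M → M) q₀ = b at *
  have h3 : tangentSign n q q₀ = b * (tangentSign n q.proj q₀.proj * a) := by
    rw [h1, ← mul_assoc, Int.units_mul_self, one_mul]
  have h4 := Int.units_mul_self a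
  rw [h3]
  calc _ = (a * a) * (tangentSign n q.proj q₀.proj * q.sign * b) := by ac_rfl
    _ = _ := by rw [h4, one_mul]

/-- The map of orientation covers induced by a local diffeomorphism. -/
noncomputable def map (f : X → M) (q : OrientationCover n X) : OrientationCover n M :=
  mk (f q.proj) (mfderivSign n f q.proj * q.sign)

theorem continuous_map {f : X → M} (hf : IsLocalDiffeomorph (𝓡 n) (𝓡 n) ∞ f) :
    Continuous (map (n := n) f) := by
  refine continuous_iff_continuousAt.2 fun q₀ => continuousAt_iff.2
    ⟨(hf.contMDiff.continuous.comp continuous_proj).continuousAt, ?_⟩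
  filter_upwards [continuous_proj.continuousAt.eventually
    (hf.eventually_tangentSign_mul_mfderivSign q₀.proj), eventually_tangentSign_mul_sign q₀]
    with q h1 h2
  simp only [map, sign_mk, proj_mk]
  rw [← mul_assoc, h1, mul_assoc, h2]

theorem contMDiff_map {f : X → M} (hf : IsLocalDiffeomorph (𝓡 n) (𝓡 n) ∞ f) :
    ContMDiff (𝓡 n) (𝓡 n) ∞ (map (n := n) f) :=
  isLocalDiffeomorph_proj.contMDiff_of_comp (continuous_map hf)
    (hf.contMDiff.comp isLocalDiffeomorph_proj.contMDiff)

theorem map_map_of_leftInverse {f : X → M} {g : M → X} (hf : IsLocalDiffeomorph (𝓡 n) (𝓡 n) ∞ f)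
    (hg : IsLocalDiffeomorph (𝓡 n) (𝓡 n) ∞ g) (h : Function.LeftInverse g f)
    (q : OrientationCover n X) : map g (map f q) = q := by
  have h1 : mfderivCoord n g (f q.proj) ∘L mfderivCoord n f q.proj = .id ℝ _ := by
    rw [← mfderivCoord_comp (hg.mdifferentiable (by simp) _) (hf.mdifferentiable (by simp) _),
      h.comp_eq_id, mfderivCoord_id]
  have h2 : mfderivSign n g (f q.proj) * mfderivSign n f q.proj = 1 := by
    rw [mfderivSign, mfderivSign, ← orientSign_comp (hg.det_mfderivCoord_ne_zero _)
      (hf.det_mfderivCoord_ne_zero _), h1, orientSign_id]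
  refine OrientationCover.ext (h q.proj) ?_
  simp only [map, sign_mk, proj_mk]
  rw [← mul_assoc, h2, one_mul]

/-- The lift of a diffeomorphism to the orientation covers. -/
noncomputable def mapDiffeomorph (f : X ≃ₘ⟮𝓡 n, 𝓡 n⟯ M) :
    OrientationCover n X ≃ₘ⟮𝓡 n, 𝓡 n⟯ OrientationCover n M where
  toFun := map f
  invFun := map f.symm
  left_inv := map_map_of_leftInverse f.isLocalDiffeomorph f.symm.isLocalDiffeomorph f.left_inv
  right_inv := map_map_of_leftInverse f.symm.isLocalDiffeomorph f.isLocalDiffeomorph f.right_inv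
  contMDiff_toFun := contMDiff_map f.isLocalDiffeomorph
  contMDiff_invFun := contMDiff_map f.symm.isLocalDiffeomorph

/-- The deck transformation reversing all orientations. -/
def flip (q : OrientationCover n M) : OrientationCover n M := mk q.proj (-q.sign)

theorem continuous_flip : Continuous (flip (n := n) (M := M)) := by
  refine continuous_iff_continuousAt.2 fun q₀ => continuousAt_iff.2
    ⟨continuous_proj.continuousAt, ?_⟩
  filter_upwards [eventually_tangentSign_mul_sign q₀] with q h
  simp only [flip, sign_mk, proj_mk, mul_neg, h]

theorem eq_or_eq_flip {q r : OrientationCover n M} (h : q.proj = r.proj) :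
    q = r ∨ q = flip r := by
  have hs : q.sign = r.sign ∨ q.sign = -r.sign := by
    rcases Int.units_eq_one_or q.sign with h1 | h1 <;>
      rcases Int.units_eq_one_or r.sign with h2 | h2 <;> simp [h1, h2]
  rcases hs with h' | h'
  · exact Or.inl (OrientationCover.ext h h')
  · exact Or.inr (OrientationCover.ext h h')

/-- The saturation of `U` is `U ∪ flip ⁻¹' U`, which is clopen; since the projection is a quotient
map, the image of `U` is clopen in the connected base. -/
theorem surjOn_proj_of_isClopen [ConnectedSpace M] {U : Set (OrientationCover n M)}
    (hU : IsClopen U) (hne : U.Nonempty) : SurjOn TotalSpace.proj U (univ : Set M) := by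
  have hpre : (TotalSpace.proj : OrientationCover n M → M) ⁻¹' (TotalSpace.proj '' U) =
      U ∪ flip ⁻¹' U := by
    ext q
    constructor
    · rintro ⟨r, hr, hrq⟩
      rcases eq_or_eq_flip hrq with rfl | rfl
      · exact Or.inl hr
      · exact Or.inr hr
    · rintro (h | h)
      · exact ⟨q, h, rfl⟩
      · exact ⟨flip q, h, rfl⟩
  have hq := isCoveringMap_proj.isQuotientMap
    (fun x => ⟨mk x 1, rfl⟩ : Function.Surjective (TotalSpace.proj : OrientationCover n M → M))
  have hclopen : IsClopen ((TotalSpace.proj : OrientationCover n M → M) '' U) := by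
    rw [← hq.isClopen_preimage, hpre]
    exact hU.union (hU.preimage continuous_flip)
  rcases isClopen_iff.1 hclopen with h | h
  · exact absurd h (hne.image _).ne_empty
  · exact h.ge

/-- The orientation cover of a connected non-orientable manifold is connected. -/
theorem connectedSpace [ConnectedSpace M] (hM : ¬ IsOrientableManifold n M) :
    ConnectedSpace (OrientationCover n M) := by
  have hpre : PreconnectedSpace (OrientationCover n M) := by
    refine preconnectedSpace_iff_clopen.2 fun U hU => ?_
    by_contra! hcon
    apply hM
    have h1 := surjOn_proj_of_isClopen hU hcon.1
    have h2 := surjOn_proj_of_isClopen hU.compl (nonempty_compl.2 hcon.2)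
    -- Both `U` and its complement meet every two-point fibre, so each contains exactly one of its
    -- points.
    have huniq : ∀ {q r : OrientationCover n M}, q ∈ U → r ∈ U → q.proj = r.proj → q = r := by
      intro q r hq hr hqr
      obtain ⟨t, ht, htr⟩ := h2 (mem_univ r.proj)
      rcases eq_or_eq_flip htr with rfl | rfl
      · exact absurd hr ht
      · rcases eq_or_eq_flip hqr with rfl | rfl
        · rfl
        · exact absurd hq ht
    choose σ hσU hσ using fun x => h1 (mem_univ x)
    refine isOrientableManifold_of_eventually (fun x => sign (σ x)) fun x₀ => ?_
    -- `τ` extends `σ x₀` with constant sign in the chart at `x₀`. Being continuous at `x₀`, it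
    -- stays in `U` nearby and so coincides with `σ` there.
    let τ : M → OrientationCover n M := fun x => mk x (tangentSign n x x₀ * sign (σ x₀))
    have hτ₀ : τ x₀ = σ x₀ := OrientationCover.ext (hσ x₀).symm (by simp [τ])
    have hτ : ContinuousAt τ x₀ := by
      refine continuousAt_iff.2 ⟨continuousAt_id, Eventually.of_forall fun x => ?_⟩
      simp only [τ, sign_mk, proj_mk, tangentSign_self, one_mul]
      rw [← mul_assoc, Int.units_mul_self, one_mul]
    filter_upwards [hτ.eventually (hU.isOpen.mem_nhds (hτ₀ ▸ hσU x₀))] with x hx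
    rw [← huniq hx (hσU x) (hσ x).symm]
    simp only [τ, sign_mk]
    rw [← mul_assoc, Int.units_mul_self, one_mul]
  exact { toNonempty := ⟨mk (Classical.arbitrary M) 1⟩ }

end OrientationCover

theorem mainTheorem4 (n : ℕ) (M : Type u) [TopologicalSpace M] [T2Space M]
    [SecondCountableTopology M] [ConnectedSpace M]
    [ChartedSpace (EuclideanSpace ℝ (Fin n)) M] [IsManifold (𝓡 n) ∞ M]
    (hM : ¬ IsOrientableManifold n M) :
    ∃ (N : Type u) (_ : TopologicalSpace N) (_ : ChartedSpace (EuclideanSpace ℝ (Fin n)) N)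
      (p : N → M),
      IsManifold (𝓡 n) ∞ N ∧ T2Space N ∧ SecondCountableTopology N ∧ ConnectedSpace N ∧
      IsOrientableManifold n N ∧ IsSmoothTwoFoldCovering n p ∧
      ∀ f : M ≃ₘ⟮𝓡 n, 𝓡 n⟯ M, ∃ g : N ≃ₘ⟮𝓡 n, 𝓡 n⟯ N, ∀ y : N, p (g y) = f (p y) :=
  ⟨OrientationCover n M, inferInstance, inferInstance, TotalSpace.proj, inferInstance,
    inferInstance, inferInstance, OrientationCover.connectedSpace hM,
    OrientationCover.isOrientableManifold, OrientationCover.isSmoothTwoFoldCovering_proj,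
    fun f => ⟨OrientationCover.mapDiffeomorph f, fun _ => rfl⟩⟩
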